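/- All Hilbert spaces are complex and of arbitrary dimension. A bounded operator $T\in\mathcal B(\mathcal H,\mathcal K)$ between Hilbert spaces is called an $\mathcal{AN}$ (absolutely norming) operator if for every nonzero closed subspace $\mathcal M\subseteq\mathcal H$ there is $x\in\mathcal M$ with $\|x\|=1$ and $\|T|_{\mathcal M}\|=\|Tx\|$. Let $\mathcal B(\mathcal H)_{\mathcal{AN}^+}$ denote the set of positive $\mathcal{AN}$ operators on a Hilbert space $\mathcal H$. Then: 1. if $S,T\in\mathcal B(\mathcal H)_{\mathcal{AN}^+}$, then $S+T\in\mathcal B(\mathcal H)_{\mathcal{AN}^+}$; 2. if $T\in\mathcal B(\mathcal H)_{\mathcal{AN}^+}$ and $c\in\mathbb R$, $c\ge 0$, then $cT\in\mathcal B(\mathcal H)_{\mathcal{AN}^+}$; 3. $\mathcal B(\mathcal H)_{\mathcal{AN}^+}\cap\bigl(-\mathcal B(\mathcal H)_{\mathcal{AN}^+}\bigr)=\{0\}$. Consequently $\mathcal B(\mathcal H)_{\mathcal{AN}^+}$ is a proper cone in the real Banach space $\mathcal B(\mathcal H)_{sa}=\{T\in\mathcal B(\mathcal H):T=T^*\}$,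 where a cone (a set containing $0$ and closed under addition and under multiplication by nonnegative reals) is called proper if it meets its negative only in $\{0\}$. By contrast, the class of all $\mathcal{AN}$ operators is closed under scalar multiplication (if $T\in\mathcal B(\mathcal H,\mathcal K)$ is $\mathcal{AN}$ and $c\in\mathbb C$, then $cT$ is $\mathcal{AN}$) but not under addition: there are $\mathcal{AN}$ operators $S,T\in\mathcal B(\ell^2(\mathbb N))$ such that $S+T$ is not $\mathcal{AN}$. -/

import Mathlib

open scoped Pointwise

section ANOperators

variable {H K : Type*} [NormedAddCommGroup H] [InnerProductSpace ℂ H]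
  [NormedAddCommGroup K] [InnerProductSpace ℂ K]

/-- `T` is norming (an `𝒩` operator): it attains its operator norm on the unit sphere. -/
def IsNorming (T : H →L[ℂ] K) : Prop :=
  ∃ x : H, ‖x‖ = 1 ∧ ‖T‖ = ‖T x‖

/-- `T` is absolutely norming (an `𝒜𝒩` operator): its restriction to every nonzero closed
subspace is norming. -/
def IsAN (T : H →L[ℂ] K) : Prop :=
  ∀ M : Submodule ℂ H, IsClosed (M : Set H) → M ≠ ⊥ → IsNorming (T.comp M.subtypeL)

end ANOperators

/-- The set of positive `𝒜𝒩` operators on `H`. -/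
def positiveAN (H : Type*) [NormedAddCommGroup H] [InnerProductSpace ℂ H] :
    Set (H →L[ℂ] H) :=
  {T | T.IsPositive ∧ IsAN T}

open Filter Topology ContinuousLinearMap
open scoped InnerProductSpace

section FiniteCodim

variable {E K : Type*} [NormedAddCommGroup E] [InnerProductSpace ℂ E]
  [NormedAddCommGroup K] [InnerProductSpace ℂ K]

/-- `p` holds on the orthogonal complement of some finite-dimensional subspace. -/
def OnFiniteCodim (p : E → Prop) : Prop :=
  ∃ F : Submodule ℂ E, FiniteDimensional ℂ F ∧ ∀ x ∈ Fᗮ, p x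

theorem OnFiniteCodim.mono {p q : E → Prop} (hp : OnFiniteCodim p) (h : ∀ x, p x → q x) :
    OnFiniteCodim q := by
  obtain ⟨F, hF, hFp⟩ := hp
  exact ⟨F, hF, fun x hx => h x (hFp x hx)⟩

theorem OnFiniteCodim.and {p q : E → Prop} (hp : OnFiniteCodim p) (hq : OnFiniteCodim q) :
    OnFiniteCodim fun x => p x ∧ q x := by
  obtain ⟨F, hF, hFp⟩ := hp
  obtain ⟨G, hG, hGq⟩ := hq
  exact ⟨F ⊔ G, inferInstance, fun x hx =>
    ⟨hFp x (Submodule.orthogonal_le le_sup_left hx),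
      hGq x (Submodule.orthogonal_le le_sup_right hx)⟩⟩

theorem OnFiniteCodim.comp [CompleteSpace E] [CompleteSpace K] {p : K → Prop}
    (hp : OnFiniteCodim p) (A : E →L[ℂ] K) : OnFiniteCodim fun x => p (A x) := by
  obtain ⟨F, hF, hFp⟩ := hp
  refine ⟨F.map (adjoint A : K →ₗ[ℂ] E), inferInstance, fun x hx => hFp _ ?_⟩
  rw [Submodule.mem_orthogonal] at hx ⊢
  intro u hu
  rw [← adjoint_inner_left]
  exact hx _ (Submodule.mem_map_of_mem hu)

end FiniteCodim

section Norming

variable {E K : Type*} [NormedAddCommGroup E] [InnerProductSpace ℂ E]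
  [NormedAddCommGroup K] [InnerProductSpace ℂ K]

theorem IsNorming.of_apply_eq {T : E →L[ℂ] K} {x : E} (hx : x ≠ 0) (h : ‖T‖ * ‖x‖ ≤ ‖T x‖) :
    IsNorming T := by
  have hx' : 0 < ‖x‖ := norm_pos_iff.2 hx
  refine ⟨((‖x‖⁻¹ : ℝ) : ℂ) • x, ?_, ?_⟩
  · rw [norm_smul]; simp [hx'.ne']
  · have := le_antisymm h (T.le_opNorm x)
    rw [map_smul, norm_smul, ← this]
    simp only [Complex.norm_real, norm_inv, norm_norm]
    field_simp

theorem isNorming_of_finiteDimensional [FiniteDimensional ℂ E] [Nontrivial E] (T : E →L[ℂ] K) :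
    IsNorming T := by
  have : ProperSpace E := FiniteDimensional.proper ℂ E
  obtain ⟨x, hx, hmax⟩ := (isCompact_sphere (0 : E) 1).exists_isMaxOn
    (NormedSpace.sphere_nonempty (E := E).2 zero_le_one) (f := fun x => ‖T x‖) (by fun_prop)
  have hx1 : ‖x‖ = 1 := by simpa using hx
  refine ⟨x, hx1, le_antisymm ?_ ?_⟩
  · refine T.opNorm_le_of_unit_norm (norm_nonneg _) fun y hy => ?_
    exact hmax (by simpa using hy)
  · simpa [hx1] using T.le_opNorm x

/-- An operator whose norm exceeds its norm on a subspace of finite codimension is norming. -/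
theorem isNorming_of_lt_opNorm [CompleteSpace E] {T : E →L[ℂ] K} {c : ℝ} (hc0 : 0 ≤ c)
    (hc : c < ‖T‖) (h : OnFiniteCodim fun x => ‖T x‖ ≤ c * ‖x‖) : IsNorming T := by
  obtain ⟨F, hF, hFc⟩ := h
  set s := ‖T‖ with hs
  have hs0 : 0 < s := hc0.trans_lt hc
  set q : E → ℝ := fun x => s ^ 2 * ‖x‖ ^ 2 - ‖T x‖ ^ 2 with hq
  have hq0 : ∀ x, 0 ≤ q x := fun x => by
    have := pow_le_pow_left₀ (norm_nonneg _) (T.le_opNorm x) 2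
    rw [mul_pow] at this
    exact sub_nonneg.2 this
  have hqsub : ∀ x y, q (x - y) ≤ 2 * q x + 2 * q y := fun x y => by
    have h1 := parallelogram_law_with_norm ℂ x y
    have h2 := parallelogram_law_with_norm ℂ (T x) (T y)
    have h3 := hq0 (x + y)
    simp only [hq, map_sub, map_add] at h3 ⊢
    nlinarith
  have hqle : ∀ x, q x ≤ s ^ 2 * ‖x‖ ^ 2 := fun x => sub_le_self _ (sq_nonneg _)
  have hqF : ∀ x ∈ Fᗮ, (s ^ 2 - c ^ 2) * ‖x‖ ^ 2 ≤ q x := fun x hx => by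
    have := pow_le_pow_left₀ (norm_nonneg _) (hFc x hx) 2
    simp only [hq]
    nlinarith
  have hδ : 0 < s ^ 2 - c ^ 2 := by nlinarith
  set δ := s ^ 2 - c ^ 2
  have hseq : ∀ n : ℕ, ∃ x : E, ‖x‖ < 1 ∧ s - 1 / (n + 1) < ‖T x‖ := fun n =>
    T.exists_lt_apply_of_lt_opNorm (sub_lt_self _ (by positivity))
  choose x hx1 hxT using hseq
  have hTx : Tendsto (fun n => ‖T (x n)‖) atTop (𝓝 s) := by
    refine tendsto_of_tendsto_of_tendsto_of_le_of_le (g := fun n : ℕ => s - 1 / ((n : ℝ) + 1))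
      (h := fun _ => s) ?_ tendsto_const_nhds (fun n => (hxT n).le) fun n => ?_
    · simpa using tendsto_const_nhds.sub (tendsto_one_div_add_atTop_nhds_zero_nat (𝕜 := ℝ))
    · exact (T.le_opNorm _).trans (mul_le_of_le_one_right hs0.le (hx1 n).le)
  have hqx : Tendsto (fun n => q (x n)) atTop (𝓝 0) := by
    refine squeeze_zero (g := fun n => s ^ 2 - ‖T (x n)‖ ^ 2) (fun n => hq0 _) (fun n => ?_) ?_
    · have : ‖x n‖ ^ 2 ≤ 1 := pow_le_one₀ (norm_nonneg _) (hx1 n).le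
      simp only [hq]
      nlinarith [sq_nonneg s]
    · have := (hTx.pow 2).const_sub (s ^ 2)
      rwa [sub_self] at this
  have : ProperSpace F := FiniteDimensional.proper ℂ F
  obtain ⟨y, -, φ, hφ, hy⟩ := (isCompact_closedBall (0 : F) 1).tendsto_subseq
    (x := fun n => F.orthogonalProjectionOnto (x n)) fun n => by
      simpa using (F.norm_orthogonalProjectionOnto_apply_le (x n)).trans (hx1 n).le
  have hyn : Tendsto (fun n => ‖F.orthogonalProjectionOnto (x (φ n)) - y‖ ^ 2) atTop (𝓝 0) := by
    simpa using (tendsto_iff_norm_sub_tendsto_zero.1 hy).pow 2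
  set d : ℕ → ℝ := fun n => (8 / δ) * q (x (φ n)) +
    (8 * s ^ 2 / δ + 4) * ‖F.orthogonalProjectionOnto (x (φ n)) - y‖ ^ 2 with hd
  have hd0 : Tendsto d atTop (𝓝 0) := by
    have := ((hqx.comp hφ.tendsto_atTop).const_mul (8 / δ)).add
      (hyn.const_mul (8 * s ^ 2 / δ + 4))
    rwa [mul_zero, mul_zero, add_zero] at this
  have hcau : CauchySeq fun n => x (φ n) := by
    have key : ∀ n m, ‖x (φ n) - x (φ m)‖ ^ 2 ≤ d n + d m := fun n m => by
      set w := x (φ n) - x (φ m) with hw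
      set p : E := (F.orthogonalProjectionOnto w : E) with hp
      have hwp : w - p ∈ Fᗮ := F.sub_starProjection_mem_orthogonal w
      have h1 : ‖w‖ ^ 2 ≤ 2 * ‖w - p‖ ^ 2 + 2 * ‖p‖ ^ 2 := by
        have := norm_add_le (w - p) p
        rw [sub_add_cancel] at this
        nlinarith [norm_nonneg w, sq_nonneg (‖w - p‖ - ‖p‖)]
      have h2 : δ * ‖w - p‖ ^ 2 ≤
          4 * q (x (φ n)) + 4 * q (x (φ m)) + 2 * s ^ 2 * ‖p‖ ^ 2 := by
        linarith [hqF _ hwp, hqsub w p, hqsub (x (φ n)) (x (φ m)), hqle p]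
      have h3 : ‖p‖ ^ 2 ≤ 2 * ‖F.orthogonalProjectionOnto (x (φ n)) - y‖ ^ 2 +
          2 * ‖F.orthogonalProjectionOnto (x (φ m)) - y‖ ^ 2 := by
        have := norm_sub_le (F.orthogonalProjectionOnto (x (φ n)) - y)
          (F.orthogonalProjectionOnto (x (φ m)) - y)
        rw [sub_sub_sub_cancel_right, ← map_sub] at this
        have hp' : ‖p‖ = ‖F.orthogonalProjectionOnto w‖ := rfl
        rw [← hw, ← hp'] at this
        nlinarith [norm_nonneg p, sq_nonneg (‖F.orthogonalProjectionOnto (x (φ n)) - y‖ -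
          ‖F.orthogonalProjectionOnto (x (φ m)) - y‖)]
      have h4 : ‖w - p‖ ^ 2 ≤
          (4 * q (x (φ n)) + 4 * q (x (φ m)) + 2 * s ^ 2 * ‖p‖ ^ 2) / δ := by
        rw [le_div_iff₀ hδ]; linarith
      have h5 : (4 * s ^ 2 / δ + 2) * ‖p‖ ^ 2 ≤ (4 * s ^ 2 / δ + 2) *
          (2 * ‖F.orthogonalProjectionOnto (x (φ n)) - y‖ ^ 2 +
          2 * ‖F.orthogonalProjectionOnto (x (φ m)) - y‖ ^ 2) :=
        mul_le_mul_of_nonneg_left h3 (by positivity)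
      calc ‖w‖ ^ 2 ≤ 2 * ((4 * q (x (φ n)) + 4 * q (x (φ m)) + 2 * s ^ 2 * ‖p‖ ^ 2) / δ)
            + 2 * ‖p‖ ^ 2 := by linarith
        _ = (8 / δ) * q (x (φ n)) + (8 / δ) * q (x (φ m)) + (4 * s ^ 2 / δ + 2) * ‖p‖ ^ 2 := by
          ring
        _ ≤ _ := add_le_add_right h5 _
        _ = d n + d m := by simp only [hd]; ring
    rw [Metric.cauchySeq_iff]
    intro ε hε
    obtain ⟨N, hN⟩ := eventually_atTop.1 (hd0.eventually (gt_mem_nhds (half_pos (pow_pos hε 2))))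
    refine ⟨N, fun m hm n hn => ?_⟩
    rw [dist_eq_norm]
    refine lt_of_pow_lt_pow_left₀ 2 hε.le ?_
    linarith [key m n, hN m hm, hN n hn]
  obtain ⟨z, hz⟩ := cauchySeq_tendsto_of_complete hcau
  have hz1 : ‖z‖ ≤ 1 := le_of_tendsto hz.norm (Eventually.of_forall fun n => (hx1 _).le)
  have hTz : ‖T z‖ = s := tendsto_nhds_unique ((T.continuous.tendsto z).comp hz).norm
    (hTx.comp hφ.tendsto_atTop)
  refine IsNorming.of_apply_eq (x := z) ?_ ?_
  · rintro rfl
    simp at hTz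
    exact hs0.ne hTz
  · rw [hTz]
    exact mul_le_of_le_one_right hs0.le hz1

end Norming

section EssentialModulus

variable {H K : Type*} [NormedAddCommGroup H] [InnerProductSpace ℂ H]
  [NormedAddCommGroup K] [InnerProductSpace ℂ K]

/-- Up to subspaces of finite codimension, `‖T x‖` is at least `α * ‖x‖`, and at most
`(α + ε) * ‖x‖` for each `ε > 0`. -/
structure HasEssentialModulus (T : H →L[ℂ] K) (α : ℝ) : Prop where
  nonneg : 0 ≤ α
  lower : OnFiniteCodim fun x => α * ‖x‖ ≤ ‖T x‖
  upper : ∀ ε > 0, OnFiniteCodim fun x => ‖T x‖ ≤ (α + ε) * ‖x‖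

/-- The analogue of `HasEssentialModulus` for the quadratic form of `T`. -/
structure HasEssentialForm (T : H →L[ℂ] H) (α : ℝ) : Prop where
  nonneg : 0 ≤ α
  lower : OnFiniteCodim fun x => α * ‖x‖ ^ 2 ≤ T.reApplyInnerSelf x
  upper : ∀ ε > 0, OnFiniteCodim fun x => T.reApplyInnerSelf x ≤ (α + ε) * ‖x‖ ^ 2

theorem HasEssentialModulus.comp_subtypeL [CompleteSpace H] {T : H →L[ℂ] K} {α : ℝ}
    (hT : HasEssentialModulus T α) (M : Submodule ℂ H) [CompleteSpace M] :
    HasEssentialModulus (T.comp M.subtypeL) α where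
  nonneg := hT.nonneg
  lower := hT.lower.comp M.subtypeL
  upper ε hε := (hT.upper ε hε).comp M.subtypeL

theorem HasEssentialModulus.isNorming [CompleteSpace H] [Nontrivial H] {T : H →L[ℂ] K} {α : ℝ}
    (hT : HasEssentialModulus T α) : IsNorming T := by
  rcases lt_or_ge α ‖T‖ with h | h
  · have := hT.nonneg
    exact isNorming_of_lt_opNorm (c := α + (‖T‖ - α) / 2) (by linarith) (by linarith)
      (hT.upper _ (by linarith))
  · obtain ⟨F, hF, hFα⟩ := hT.lower
    by_cases hbot : Fᗮ = ⊥
    · rw [Submodule.orthogonal_eq_bot_iff] at hbot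
      subst hbot
      have : FiniteDimensional ℂ H := Module.Finite.equiv Submodule.topEquiv
      exact isNorming_of_finiteDimensional T
    · obtain ⟨x, hx, hx0⟩ := Submodule.exists_mem_ne_zero_of_ne_bot hbot
      exact IsNorming.of_apply_eq hx0
        ((mul_le_mul_of_nonneg_right h (norm_nonneg _)).trans (hFα x hx))

theorem HasEssentialModulus.isAN [CompleteSpace H] {T : H →L[ℂ] K} {α : ℝ}
    (hT : HasEssentialModulus T α) : IsAN T := by
  intro M hM hM0
  have : CompleteSpace M := hM.completeSpace_coe
  have : Nontrivial M := Submodule.nontrivial_iff_ne_bot.2 hM0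
  exact (hT.comp_subtypeL M).isNorming

end EssentialModulus

section Converse

variable {H K : Type*} [NormedAddCommGroup H] [InnerProductSpace ℂ H]
  [NormedAddCommGroup K] [InnerProductSpace ℂ K]

theorem pairwise_inner_eq_zero_of_lt {ι : Type*} [LinearOrder ι] {f : ι → H}
    (hf : ∀ i j, i < j → ⟪f i, f j⟫_ℂ = 0) : Pairwise fun i j => ⟪f i, f j⟫_ℂ = 0 := by
  intro i j hij
  rcases lt_or_gt_of_ne hij with h | h
  · exact hf i j h
  · exact inner_eq_zero_symm.1 (hf j i h)

theorem HasSum.norm_sq_of_pairwise_inner_eq_zero {ι : Type*} {f : ι → H} {y : H} (hf : HasSum f y)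
    (horth : Pairwise fun i j => ⟪f i, f j⟫_ℂ = 0) :
    HasSum (fun i => ‖f i‖ ^ 2) (‖y‖ ^ 2) := by
  have h1 : ∀ i, ⟪f i, y⟫_ℂ = ((‖f i‖ ^ 2 : ℝ) : ℂ) := fun i => by
    have h2 : HasSum (fun j => ⟪f i, f j⟫_ℂ) ⟪f i, y⟫_ℂ := hf.mapL (innerSL ℂ (f i))
    have h3 := hasSum_single (f := fun j => ⟪f i, f j⟫_ℂ) i fun j hj => horth hj.symm
    rw [h2.unique h3, inner_self_eq_norm_sq_to_K]
    simp
  have h4 : HasSum (fun i => ⟪y, f i⟫_ℂ) ⟪y, y⟫_ℂ := hf.mapL (innerSL ℂ y)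
  have h5 : ∀ i, ⟪y, f i⟫_ℂ = ((‖f i‖ ^ 2 : ℝ) : ℂ) := fun i => by
    rw [← inner_conj_symm, h1, Complex.conj_ofReal]
  simp only [h5] at h4
  rw [← inner_self_eq_norm_sq (𝕜 := ℂ) y]
  simpa only [Complex.reCLM_apply, Complex.ofReal_re] using! h4.mapL Complex.reCLM

theorem not_isAN_of_orthonormal [CompleteSpace H] {T : H →L[ℂ] K} {z : ℕ → H}
    (hz : Orthonormal ℂ z) (hTz : Pairwise fun i j => ⟪T (z i), T (z j)⟫_ℂ = 0) {α : ℝ}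
    (hlt : ∀ n, ‖T (z n)‖ < α) (hsup : ∀ c < α, ∃ n, c < ‖T (z n)‖) : ¬ IsAN T := by
  intro hAN
  set V := hz.orthogonalFamily.linearIsometry
  set M : Submodule ℂ H := LinearMap.range V.toLinearMap with hM
  have hMc : IsClosed (M : Set H) := V.isometry.isUniformInducing.isComplete_range.isClosed
  have hzM : ∀ n, z n ∈ M := fun n => ⟨lp.single 2 n (1 : ℂ), by simp [V]⟩
  have hM0 : M ≠ ⊥ := fun h => hz.ne_zero 0 (by simpa [h] using hzM 0)
  obtain ⟨⟨x, f, hf⟩, hx1, hxT⟩ := hAN M hMc hM0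
  have hx1 : ‖x‖ = 1 := hx1
  have hxT : ‖T.comp M.subtypeL‖ = ‖T x‖ := hxT
  have hα : 0 < α := (norm_nonneg _).trans_lt (hlt 0)
  obtain ⟨c, hsum⟩ : ∃ c : ℕ → ℂ, HasSum (fun n => c n • z n) x := by
    rw [← hf]
    exact ⟨f, hz.orthogonalFamily.hasSum_linearIsometry f⟩
  have hn : HasSum (fun n => ‖c n • z n‖ ^ 2) (‖x‖ ^ 2) :=
    hsum.norm_sq_of_pairwise_inner_eq_zero fun i j hij => by
      beta_reduce
      rw [inner_smul_left, inner_smul_right, hz.2 hij, mul_zero, mul_zero]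
  have hTn : HasSum (fun n => ‖T (c n • z n)‖ ^ 2) (‖T x‖ ^ 2) :=
    (hsum.mapL T).norm_sq_of_pairwise_inner_eq_zero fun i j hij => by
      beta_reduce
      rw [map_smul, map_smul, inner_smul_left, inner_smul_right, hTz hij, mul_zero, mul_zero]
  have hne : ∃ n, c n ≠ 0 := by
    by_contra! h
    have : x = 0 := hsum.unique (by simp [h, hasSum_zero])
    simp [this] at hx1
  obtain ⟨m, hm⟩ := hne
  have hle : ∀ n, ‖T (c n • z n)‖ ≤ α * ‖c n • z n‖ := fun n => by
    rw [map_smul, norm_smul, norm_smul, hz.1 n, mul_one, mul_comm]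
    exact mul_le_mul_of_nonneg_right (hlt n).le (norm_nonneg _)
  have hlt' : ‖T (c m • z m)‖ < α * ‖c m • z m‖ := by
    rw [map_smul, norm_smul, norm_smul, hz.1 m, mul_one, mul_comm]
    exact mul_lt_mul_of_pos_right (hlt m) (norm_pos_iff.2 hm)
  have hlt2 : ‖T x‖ ^ 2 < α ^ 2 * ‖x‖ ^ 2 := by
    refine hasSum_lt (fun n => ?_) (i := m) ?_ hTn (hn.mul_left (α ^ 2))
    · simpa only [mul_pow] using pow_le_pow_left₀ (norm_nonneg _) (hle n) 2
    · simpa only [mul_pow] using pow_lt_pow_left₀ hlt' (norm_nonneg _) two_ne_zero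
  rw [hx1, one_pow, mul_one] at hlt2
  obtain ⟨n, hn⟩ := hsup ‖T x‖ (lt_of_pow_lt_pow_left₀ 2 hα.le hlt2)
  have := (T.comp M.subtypeL).le_opNorm ⟨z n, hzM n⟩
  rw [hxT] at this
  have h1 : ‖(⟨z n, hzM n⟩ : M)‖ = 1 := hz.1 n
  rw [h1, mul_one] at this
  exact absurd hn (not_lt.2 this)

theorem exists_norm_eq_one_of_lt_of_lt {T : H →L[ℂ] K} (N : Submodule ℂ H) {x y : H} {a b : ℝ}
    (hab : a < b) (hx : x ∈ N) (hy : y ∈ N) (hxb : ‖T x‖ < b * ‖x‖) (hya : a * ‖y‖ < ‖T y‖) :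
    ∃ z ∈ N, ‖z‖ = 1 ∧ a < ‖T z‖ ∧ ‖T z‖ < b := by
  suffices h : ∃ z ∈ N, z ≠ 0 ∧ a * ‖z‖ < ‖T z‖ ∧ ‖T z‖ < b * ‖z‖ by
    obtain ⟨z, hzN, hz0, h1, h2⟩ := h
    have hz : 0 < ‖z‖ := norm_pos_iff.2 hz0
    refine ⟨((‖z‖⁻¹ : ℝ) : ℂ) • z, N.smul_mem _ hzN, ?_, ?_⟩
    · rw [norm_smul]; simp [hz.ne']
    · rw [map_smul, norm_smul, Complex.norm_real, norm_inv, norm_norm, inv_mul_eq_div,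
        lt_div_iff₀ hz, div_lt_iff₀ hz]
      exact ⟨h1, h2⟩
  have hx0 : x ≠ 0 := by rintro rfl; simp at hxb
  have hy0 : y ≠ 0 := by rintro rfl; simp at hya
  by_cases h1 : a * ‖x‖ < ‖T x‖
  · exact ⟨x, hx, hx0, h1, hxb⟩
  by_cases h2 : ‖T y‖ < b * ‖y‖
  · exact ⟨y, hy, hy0, hya, h2⟩
  push Not at h1 h2
  set m := (a + b) / 2 with hm
  have hx' := norm_pos_iff.2 hx0
  have hy' := norm_pos_iff.2 hy0
  set p : ℝ → H := fun t => ((1 - t : ℝ) : ℂ) • x + ((t : ℝ) : ℂ) • y with hp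
  have hcont : Continuous fun t => ‖T (p t)‖ - m * ‖p t‖ := by
    simp only [hp]
    fun_prop
  have h01 : (0 : ℝ) ∈ Set.Icc (‖T (p 0)‖ - m * ‖p 0‖) (‖T (p 1)‖ - m * ‖p 1‖) := by
    simp only [hp]
    constructor <;> simp <;> nlinarith
  obtain ⟨t, ht, h0⟩ := intermediate_value_Icc zero_le_one hcont.continuousOn h01
  have hpt : ‖T (p t)‖ = m * ‖p t‖ := sub_eq_zero.1 h0
  have hpt0 : p t ≠ 0 := by
    intro hpt0
    have hxy : ((1 - t : ℝ) : ℂ) • x = -(((t : ℝ) : ℂ) • y) := eq_neg_of_add_eq_zero_left hpt0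
    have e1 : (1 - t) * ‖x‖ = t * ‖y‖ := by
      have := congrArg norm hxy
      rwa [norm_neg, norm_smul, norm_smul, Complex.norm_real, Complex.norm_real,
        Real.norm_of_nonneg (by linarith [ht.2]), Real.norm_of_nonneg ht.1] at this
    have e2 : (1 - t) * ‖T x‖ = t * ‖T y‖ := by
      have := congrArg (fun u => ‖T u‖) hxy
      simp only [map_neg, map_smul] at this
      rwa [norm_neg, norm_smul, norm_smul, Complex.norm_real, Complex.norm_real,
        Real.norm_of_nonneg (by linarith [ht.2]), Real.norm_of_nonneg ht.1] at this
    have e3 : (1 - t) * ‖T x‖ ≤ a * (t * ‖y‖) := by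
      rw [← e1]; nlinarith [mul_le_mul_of_nonneg_left h1 (sub_nonneg.2 ht.2)]
    have e4 : b * (t * ‖y‖) ≤ t * ‖T y‖ := by
      nlinarith [mul_le_mul_of_nonneg_left h2 ht.1]
    have e5 : t * ‖y‖ ≤ 0 := by nlinarith
    have ht0 : t = 0 := le_antisymm (nonpos_of_mul_nonpos_left e5 hy') ht.1
    rw [ht0] at e1
    simp at e1
    exact hx0 e1
  have := norm_pos_iff.2 hpt0
  exact ⟨p t, N.add_mem (N.smul_mem _ hx) (N.smul_mem _ hy), hpt0, by rw [hpt]; nlinarith,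
    by rw [hpt]; nlinarith⟩

theorem IsAN.exists_hasEssentialModulus [CompleteSpace H] [CompleteSpace K] {T : H →L[ℂ] K}
    (hT : IsAN T) : ∃ α, HasEssentialModulus T α := by
  set A : Set ℝ := {c | 0 ≤ c ∧ OnFiniteCodim fun x => ‖T x‖ ≤ c * ‖x‖} with hA
  have hAne : A.Nonempty := ⟨‖T‖, norm_nonneg _, ⊥, inferInstance, fun x _ => T.le_opNorm x⟩
  have hAbdd : BddBelow A := ⟨0, fun c hc => hc.1⟩
  set α := sInf A with hα
  have hα0 : 0 ≤ α := le_csInf hAne fun c hc => hc.1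
  refine ⟨α, hα0, ?_, fun ε hε => ?_⟩
  swap
  · obtain ⟨c, hc, hcε⟩ := exists_lt_of_csInf_lt hAne (lt_add_of_pos_right (sInf A) hε)
    exact hc.2.mono fun x hx => hx.trans (mul_le_mul_of_nonneg_right hcε.le (norm_nonneg _))
  by_contra hlow
  have hstep : ∀ (F : Submodule ℂ H) (a : ℝ), FiniteDimensional ℂ F → a < α →
      ∃ z ∈ Fᗮ, ‖z‖ = 1 ∧ a < ‖T z‖ ∧ ‖T z‖ < α := by
    intro F a hF ha
    have h1 : ∃ x ∈ Fᗮ, ‖T x‖ < α * ‖x‖ := by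
      by_contra! h
      exact hlow ⟨F, hF, h⟩
    obtain ⟨x, hx, hxα⟩ := h1
    have hα' : 0 < α := pos_of_mul_pos_left ((norm_nonneg _).trans_lt hxα) (norm_nonneg _)
    have h2 : ∃ y ∈ Fᗮ, max a 0 * ‖y‖ < ‖T y‖ := by
      by_contra! h
      exact (max_lt ha hα').not_ge (csInf_le hAbdd ⟨le_max_right _ _, F, hF, h⟩)
    obtain ⟨y, hy, hya⟩ := h2
    exact exists_norm_eq_one_of_lt_of_lt Fᗮ ha hx hy hxα
      ((mul_le_mul_of_nonneg_right (le_max_left _ _) (norm_nonneg _)).trans_lt hya)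
  obtain ⟨z, hz, hzr⟩ := exists_seq_of_forall_finset_exists
    (fun z : H => ‖z‖ = 1 ∧ ‖T z‖ < α)
    (fun x y => ⟪x, y⟫_ℂ = 0 ∧ ⟪T x, T y⟫_ℂ = 0 ∧ (α + ‖T x‖) / 2 < ‖T y‖) (by
      intro s hs
      obtain ⟨a, ha, has⟩ : ∃ a < α, ∀ x ∈ s, (α + ‖T x‖) / 2 ≤ a := by
        rcases s.eq_empty_or_nonempty with rfl | hne
        · exact ⟨α - 1, by linarith, by simp⟩
        · obtain ⟨m, hm, hmax⟩ := s.exists_max_image (fun x => ‖T x‖) hne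
          exact ⟨(α + ‖T m‖) / 2, by linarith [(hs m hm).2], fun x hx => by
            linarith [hmax x hx]⟩
      set F : Submodule ℂ H := Submodule.span ℂ (s : Set H)
      have hF : FiniteDimensional ℂ F := FiniteDimensional.span_finset ℂ s
      obtain ⟨y, hy, hy1, hay, hyα⟩ := hstep
        (F ⊔ F.map (adjoint T ∘L T : H →ₗ[ℂ] H)) a inferInstance ha
      refine ⟨y, ⟨hy1, hyα⟩, fun x hx => ⟨?_, ?_, (has x hx).trans_lt hay⟩⟩
      · exact hy x (Submodule.mem_sup_left (Submodule.subset_span hx))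
      · rw [← adjoint_inner_left]
        exact hy _ (Submodule.mem_sup_right
          (Submodule.mem_map_of_mem (Submodule.subset_span hx))))
  have hgeom : ∀ n, α - ‖T (z n)‖ ≤ (α - ‖T (z 0)‖) * (1 / 2) ^ n := by
    intro n
    induction n with
    | zero => simp
    | succ n ih =>
      have := (hzr n (n + 1) n.lt_succ_self).2.2
      rw [pow_succ]
      linarith
  refine not_isAN_of_orthonormal (z := z) (α := α)
    ⟨fun n => (hz n).1, pairwise_inner_eq_zero_of_lt fun m n h => (hzr m n h).1⟩
    (pairwise_inner_eq_zero_of_lt fun m n h => (hzr m n h).2.1) (fun n => (hz n).2) ?_ hT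
  intro c hc
  have hlim : Tendsto (fun n : ℕ => (α - ‖T (z 0)‖) * (1 / 2 : ℝ) ^ n) atTop (𝓝 0) := by
    simpa using (tendsto_pow_atTop_nhds_zero_of_lt_one (r := (1 / 2 : ℝ)) (by norm_num)
      (by norm_num)).const_mul (α - ‖T (z 0)‖)
  obtain ⟨n, hn⟩ := (hlim.eventually (gt_mem_nhds (sub_pos.2 hc))).exists
  exact ⟨n, by linarith [hgeom n]⟩

end Converse

section Positive

variable {H : Type*} [NormedAddCommGroup H] [InnerProductSpace ℂ H]

theorem HasEssentialForm.add {S T : H →L[ℂ] H} {α β : ℝ} (hS : HasEssentialForm S α)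
    (hT : HasEssentialForm T β) : HasEssentialForm (S + T) (α + β) where
  nonneg := add_nonneg hS.nonneg hT.nonneg
  lower := (hS.lower.and hT.lower).mono fun x hx => by
    simp only [reApplyInnerSelf_apply, add_apply, inner_add_left, map_add] at hx ⊢
    linarith [hx.1, hx.2]
  upper ε hε := ((hS.upper (ε / 2) (by linarith)).and (hT.upper (ε / 2) (by linarith))).mono
    fun x hx => by
      simp only [reApplyInnerSelf_apply, add_apply, inner_add_left, map_add] at hx ⊢
      linarith [hx.1, hx.2]

theorem reApplyInnerSelf_le_norm_mul_norm (T : H →L[ℂ] H) (x : H) :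
    T.reApplyInnerSelf x ≤ ‖T x‖ * ‖x‖ :=
  re_inner_le_norm _ _

variable [CompleteSpace H]

theorem HasEssentialForm.hasEssentialModulus {T : H →L[ℂ] H} (hT : T.IsPositive) {α : ℝ}
    (h : HasEssentialForm T α) : HasEssentialModulus T α where
  nonneg := h.nonneg
  lower := h.lower.mono fun x hx => by
    rcases eq_or_ne x 0 with rfl | hx0
    · simp
    have := norm_pos_iff.2 hx0
    have := hx.trans (reApplyInnerSelf_le_norm_mul_norm T x)
    nlinarith
  upper ε hε := by
    have hT0 : 0 ≤ T := (nonneg_iff_isPositive T).2 hT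
    set S := CFC.sqrt T
    have hSS : S * S = T := CFC.sqrt_mul_sqrt_self T hT0
    have hS : S.IsPositive := (nonneg_iff_isPositive S).1 (CFC.sqrt_nonneg T)
    have hSS' : ∀ x, S (S x) = T x := fun x => DFunLike.congr_fun hSS x
    have hSx : ∀ x, T.reApplyInnerSelf x = ‖S x‖ ^ 2 := fun x => by
      rw [reApplyInnerSelf_apply, ← hSS', hS.inner_left_eq_inner_right]
      exact inner_self_eq_norm_sq _
    have hαε : 0 ≤ α + ε := add_nonneg h.nonneg hε.le
    refine ((h.upper ε hε).and ((h.upper ε hε).comp S)).mono fun x hx => ?_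
    rw [hSx, hSx, hSS'] at hx
    refine le_of_sq_le_sq ?_ (mul_nonneg hαε (norm_nonneg _))
    nlinarith [mul_le_mul_of_nonneg_left hx.1 hαε]

theorem HasEssentialModulus.hasEssentialForm {T : H →L[ℂ] H} (hT : T.IsPositive) {α : ℝ}
    (h : HasEssentialModulus T α) : HasEssentialForm T α where
  nonneg := h.nonneg
  upper ε hε := (h.upper ε hε).mono fun x hx => by
    have := reApplyInnerSelf_le_norm_mul_norm T x
    nlinarith [mul_le_mul_of_nonneg_right hx (norm_nonneg x)]
  lower := by
    rcases h.nonneg.eq_or_lt with rfl | hα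
    · exact ⟨⊥, inferInstance, fun x _ => by simpa using hT.2 x⟩
    have hT0 : 0 ≤ T := (nonneg_iff_isPositive T).2 hT
    have hpos : IsStrictlyPositive (T + algebraMap ℝ (H →L[ℂ] H) α) :=
      IsStrictlyPositive.nonneg_add hT0 (isStrictlyPositive_algebraMap hα)
    set C := CFC.sqrt (T + algebraMap ℝ (H →L[ℂ] H) α)
    have hCC : C * C = T + algebraMap ℝ (H →L[ℂ] H) α := CFC.sqrt_mul_sqrt_self _ hpos.nonneg
    have hC : C.IsPositive := (nonneg_iff_isPositive C).1 (CFC.sqrt_nonneg _)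
    obtain ⟨u, hu⟩ : IsUnit C := hpos.isUnit_cfcSqrt
    have hCC' : ∀ y, C (C y) = T y + (α : ℂ) • y := fun y => by
      refine (DFunLike.congr_fun hCC y).trans ?_
      simp [Algebra.algebraMap_eq_smul_one]
    refine (h.lower.comp (↑u⁻¹ : H →L[ℂ] H)).mono fun z hz => ?_
    set y := (↑u⁻¹ : H →L[ℂ] H) z
    have hCy : C y = z := by
      rw [← hu]
      exact DFunLike.congr_fun u.mul_inv z
    have hTz : T z = C (C (C y)) - (α : ℂ) • C y := by
      rw [hCC' (C y), hCy]; simp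
    have e1 : T.reApplyInnerSelf z = ‖C (C y)‖ ^ 2 - α * ‖z‖ ^ 2 := by
      rw [reApplyInnerSelf_apply, hTz, inner_sub_left, ← hCy, hC.inner_left_eq_inner_right,
        inner_smul_left, Complex.conj_ofReal, map_sub, RCLike.re_eq_complex_re,
        Complex.re_ofReal_mul, ← RCLike.re_eq_complex_re, inner_self_eq_norm_sq,
        inner_self_eq_norm_sq]
    have e2 : ‖z‖ ^ 2 = T.reApplyInnerSelf y + α * ‖y‖ ^ 2 := by
      rw [← hCy, ← inner_self_eq_norm_sq (𝕜 := ℂ), ← hC.inner_left_eq_inner_right, hCC',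
        inner_add_left, inner_smul_left, map_add, Complex.conj_ofReal, RCLike.re_eq_complex_re,
        Complex.re_ofReal_mul, ← RCLike.re_eq_complex_re, inner_self_eq_norm_sq,
        reApplyInnerSelf_apply]
    have e3 : ‖C (C y)‖ ^ 2 =
        ‖T y‖ ^ 2 + 2 * α * T.reApplyInnerSelf y + α ^ 2 * ‖y‖ ^ 2 := by
      rw [hCC', norm_add_sq (𝕜 := ℂ), inner_smul_right, norm_smul, reApplyInnerSelf_apply]
      simp [abs_of_pos hα]
      ring
    have e4 := pow_le_pow_left₀ (by positivity) hz 2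
    rw [e1, e3]
    nlinarith

end Positive

section Cone

variable {H K : Type*} [NormedAddCommGroup H] [InnerProductSpace ℂ H]
  [NormedAddCommGroup K] [InnerProductSpace ℂ K]

theorem IsAN.smul {T : H →L[ℂ] K} (hT : IsAN T) (c : ℂ) : IsAN (c • T) := by
  intro M hM hM0
  obtain ⟨x, hx, hTx⟩ := hT M hM hM0
  exact ⟨x, hx, by rw [smul_comp, norm_smul, hTx, smul_apply, norm_smul]⟩

theorem isAN_of_isometry (V : H →ₗᵢ[ℂ] K) : IsAN V.toContinuousLinearMap := by
  intro M _ hM0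
  obtain ⟨x, hx, hx0⟩ := Submodule.exists_mem_ne_zero_of_ne_bot hM0
  refine IsNorming.of_apply_eq (x := ⟨x, hx⟩) (by simpa using hx0) ?_
  have h1 : ‖V.toContinuousLinearMap.comp M.subtypeL‖ ≤ 1 :=
    opNorm_le_bound _ zero_le_one fun y => by simp
  simpa using mul_le_mul_of_nonneg_right h1 (norm_nonneg x)

theorem isAN_zero : IsAN (0 : H →L[ℂ] K) := by
  intro M _ hM0
  obtain ⟨x, hx, hx0⟩ := Submodule.exists_mem_ne_zero_of_ne_bot hM0
  exact IsNorming.of_apply_eq (x := ⟨x, hx⟩) (by simpa using hx0) (by simp)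

theorem zero_mem_positiveAN : (0 : H →L[ℂ] H) ∈ positiveAN H := ⟨isPositive_zero, isAN_zero⟩

theorem smul_mem_positiveAN {T : H →L[ℂ] H} (hT : T ∈ positiveAN H) {c : ℝ} (hc : 0 ≤ c) :
    c • T ∈ positiveAN H := by
  rw [← Complex.coe_smul c T]
  exact ⟨hT.1.smul_of_nonneg (by exact_mod_cast hc), hT.2.smul _⟩

theorem eq_zero_of_mem_positiveAN_of_neg_mem [CompleteSpace H] {T : H →L[ℂ] H}
    (hT : T ∈ positiveAN H) (hT' : -T ∈ positiveAN H) : T = 0 :=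
  le_antisymm (neg_nonneg.1 ((nonneg_iff_isPositive _).2 hT'.1))
    ((nonneg_iff_isPositive T).2 hT.1)

theorem add_mem_positiveAN [CompleteSpace H] {S T : H →L[ℂ] H} (hS : S ∈ positiveAN H)
    (hT : T ∈ positiveAN H) : S + T ∈ positiveAN H := by
  obtain ⟨α, hα⟩ := hS.2.exists_hasEssentialModulus
  obtain ⟨β, hβ⟩ := hT.2.exists_hasEssentialModulus
  have hpos := hS.1.add hT.1
  exact ⟨hpos, (((hα.hasEssentialForm hS.1).add
    (hβ.hasEssentialForm hT.1)).hasEssentialModulus hpos).isAN⟩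

theorem positiveAN_inter_neg [CompleteSpace H] : positiveAN H ∩ -positiveAN H = {0} := by
  ext T
  constructor
  · rintro ⟨hT, hT'⟩
    exact eq_zero_of_mem_positiveAN_of_neg_mem hT hT'
  · rintro rfl
    exact ⟨zero_mem_positiveAN, by simpa using zero_mem_positiveAN⟩

/-- The positive absolutely norming operators as a cone of self-adjoint operators. -/
def positiveANCone (H : Type*) [NormedAddCommGroup H] [InnerProductSpace ℂ H] [CompleteSpace H] :
    PointedCone ℝ (selfAdjoint (H →L[ℂ] H)) where
  carrier := {T | (T : H →L[ℂ] H) ∈ positiveAN H}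
  add_mem' hS hT := add_mem_positiveAN hS hT
  zero_mem' := zero_mem_positiveAN
  smul_mem' c _ hT := smul_mem_positiveAN hT c.2

theorem image_positiveANCone [CompleteSpace H] :
    (fun T : selfAdjoint (H →L[ℂ] H) => (T : H →L[ℂ] H)) '' (positiveANCone H : Set _) =
      positiveAN H := by
  ext T
  constructor
  · rintro ⟨T, hT, rfl⟩
    exact hT
  · intro hT
    exact ⟨⟨T, hT.1.isSelfAdjoint⟩, hT, rfl⟩

theorem positiveANCone_inter_neg [CompleteSpace H] :
    (positiveANCone H : Set (selfAdjoint (H →L[ℂ] H))) ∩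
      -(positiveANCone H : Set (selfAdjoint (H →L[ℂ] H))) = {0} := by
  ext T
  constructor
  · rintro ⟨hT, hT'⟩
    exact Subtype.ext (eq_zero_of_mem_positiveAN_of_neg_mem hT hT')
  · rintro rfl
    exact ⟨zero_mem _, by simp⟩

theorem completeSpace_selfAdjoint [CompleteSpace H] :
    CompleteSpace (selfAdjoint (H →L[ℂ] H)) := by
  have h : IsClosed {T : H →L[ℂ] H | star T = T} := isClosed_eq continuous_star continuous_id
  exact h.completeSpace_coe

end Cone

section Counterexample

theorem exists_unit_seq : ∃ u : ℕ → ℂ, (∀ n, ‖u n‖ = 1) ∧ (∀ n, ‖1 + u n‖ < 2) ∧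
    Tendsto (fun n => ‖1 + u n‖) atTop (𝓝 2) := by
  set θ : ℕ → ℝ := fun n => 1 / ((n : ℝ) + 1) with hθ
  refine ⟨fun n => Complex.exp (θ n * Complex.I), fun n => Complex.norm_exp_ofReal_mul_I _,
    fun n => ?_, ?_⟩
  · have h0 : 0 < θ n := by positivity
    have h1 : θ n ≤ 1 := by
      rw [hθ]
      exact div_le_one_of_le₀ (by linarith [n.cast_nonneg (α := ℝ)]) (by positivity)
    have hcos : Real.cos (θ n) < 1 := by
      rw [← Real.cos_zero]
      exact Real.cos_lt_cos_of_nonneg_of_le_pi_div_two le_rfl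
        (by linarith [Real.pi_gt_three]) h0
    refine lt_of_pow_lt_pow_left₀ 2 zero_le_two ?_
    rw [Complex.sq_norm, Complex.normSq_apply]
    simp only [Complex.add_re, Complex.one_re, Complex.exp_ofReal_mul_I_re, Complex.add_im,
      Complex.one_im, Complex.exp_ofReal_mul_I_im]
    nlinarith [Real.sin_sq_add_cos_sq (θ n)]
  · have hθ0 : Tendsto θ atTop (𝓝 0) := tendsto_one_div_add_atTop_nhds_zero_nat
    have hcont : Continuous fun t : ℝ => ‖1 + Complex.exp (t * Complex.I)‖ := by fun_prop
    have := (hcont.tendsto 0).comp hθ0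
    norm_num at this
    exact this

theorem exists_isAN_add_not_isAN :
    ∃ S T : lp (fun _ : ℕ => ℂ) 2 →L[ℂ] lp (fun _ : ℕ => ℂ) 2,
      IsAN S ∧ IsAN T ∧ ¬ IsAN (S + T) := by
  obtain ⟨u, hu1, hu2, hulim⟩ := exists_unit_seq
  set b : HilbertBasis ℕ ℂ (lp (fun _ : ℕ => ℂ) 2) := ⟨LinearIsometryEquiv.refl ℂ _⟩
  have hb : ∀ n, b n = lp.single 2 n (1 : ℂ) := fun n => (b.repr_symm_single n).symm
  have hv : Orthonormal ℂ fun n => u n • b n := by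
    refine ⟨fun n => by rw [norm_smul, hu1, b.orthonormal.1, one_mul], fun i j hij => ?_⟩
    simp only
    rw [inner_smul_left, inner_smul_right, b.orthonormal.2 hij, mul_zero, mul_zero]
  set V := hv.orthogonalFamily.linearIsometry
  have hV : ∀ n, V (b n) = u n • b n := fun n => by
    rw [hb n, hv.orthogonalFamily.linearIsometry_apply_single]
    simp [hb]
  set I : lp (fun _ : ℕ => ℂ) 2 →ₗᵢ[ℂ] lp (fun _ : ℕ => ℂ) 2 := LinearIsometry.id
  refine ⟨I.toContinuousLinearMap, V.toContinuousLinearMap, isAN_of_isometry _,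
    isAN_of_isometry _, ?_⟩
  have hsum : ∀ n, (I.toContinuousLinearMap + V.toContinuousLinearMap) (b n) =
      (1 + u n) • b n := fun n => by
    simp [hV, add_smul, I]
  have hnorm : ∀ n, ‖(I.toContinuousLinearMap + V.toContinuousLinearMap) (b n)‖ =
      ‖1 + u n‖ := fun n => by
    rw [hsum, norm_smul, b.orthonormal.1, mul_one]
  refine not_isAN_of_orthonormal b.orthonormal (α := 2) (fun i j hij => ?_) (fun n => ?_)
    fun c hc => ?_
  · simp only
    rw [hsum, hsum, inner_smul_left, inner_smul_right, b.orthonormal.2 hij, mul_zero, mul_zero]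
  · rw [hnorm]
    exact hu2 n
  · obtain ⟨n, hn⟩ := (hulim.eventually (lt_mem_nhds hc)).exists
    exact ⟨n, by rwa [hnorm]⟩

end Counterexample

theorem mainTheorem3 {H K : Type*}
    [NormedAddCommGroup H] [InnerProductSpace ℂ H] [CompleteSpace H]
    [NormedAddCommGroup K] [InnerProductSpace ℂ K] [CompleteSpace K] :
    -- closed under addition and under multiplication by nonnegative reals
    (∀ S ∈ positiveAN H, ∀ T ∈ positiveAN H, S + T ∈ positiveAN H) ∧
    (∀ c : ℝ, 0 ≤ c → ∀ T ∈ positiveAN H, c • T ∈ positiveAN H) ∧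
    -- it meets its negative only in zero
    positiveAN H ∩ -positiveAN H = {0} ∧
    -- hence it is a proper cone in the real Banach space of self-adjoint operators
    (CompleteSpace (selfAdjoint (H →L[ℂ] H)) ∧
      ∃ C : PointedCone ℝ (selfAdjoint (H →L[ℂ] H)),
        (fun T : selfAdjoint (H →L[ℂ] H) => (T : H →L[ℂ] H)) '' (C : Set _) = positiveAN H ∧
        (C : Set (selfAdjoint (H →L[ℂ] H))) ∩ -(C : Set (selfAdjoint (H →L[ℂ] H))) = {0}) ∧
    -- the class of all `𝒜𝒩` operators is closed under scalar multiplication ...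
    (∀ (c : ℂ) (T : H →L[ℂ] K), IsAN T → IsAN (c • T)) ∧
    -- ... but not under addition
    (∃ S T : lp (fun _ : ℕ => ℂ) 2 →L[ℂ] lp (fun _ : ℕ => ℂ) 2,
      IsAN S ∧ IsAN T ∧ ¬ IsAN (S + T)) := by
  exact ⟨fun S hS T hT => add_mem_positiveAN hS hT, fun c hc T hT => smul_mem_positiveAN hT hc,
    positiveAN_inter_neg, ⟨completeSpace_selfAdjoint, positiveANCone H, image_positiveANCone,
      positiveANCone_inter_neg⟩, fun c T hT => hT.smul c, exists_isAN_add_not_isAN⟩
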